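/- Let $M$ be a closed (compact, without boundary) oriented smooth three-dimensional manifold with $H^1(M;\mathbb{R})=H^2(M;\mathbb{R})=0$, and let $\mu$ be a volume form on $M$, i.e. a smooth nowhere vanishing 3-form. A smooth vector field $X$ on $M$ is called divergence-free if $d\,i_X\mu=0$. Let $X,Y,Z$ be divergence-free vector fields on $M$. Then there is a smooth 1-form $\eta_X$ on $M$ with $d\eta_X=i_X\mu$, and the Hopf invariant $$\mathcal{H}(X,Y)=\int_M \eta_X\wedge i_Y\mu$$ does not depend on the choice of such an $\eta_X$. Furthermore $\mathcal{H}(X,Y)=\mathcal{H}(Y,X)$ and $\mathcal{H}(X,Y+Z)=\mathcal{H}(X,Y)+\mathcal{H}(X,Z)$. -/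

import Mathlib

open scoped Manifold ContDiff Topology
open MeasureTheory

noncomputable section

namespace HopfInv

/-- The model space `ℝ³` of a three-dimensional manifold. -/
abbrev E3 : Type := EuclideanSpace ℝ (Fin 3)

/-! ### Pointwise multilinear algebra -/

/-- The wedge product `a ∧ b` of a covector `a` and an alternating `k`-form `b`:
`(a ∧ b)(v₀,…,v_k) = ∑ i, (-1)^i a(v_i) b(v₀,…,v̂_i,…,v_k)`. -/
def wedgeAlt {k : ℕ} (a : E3 [⋀^Fin 1]→L[ℝ] ℝ) (b : E3 [⋀^Fin k]→L[ℝ] ℝ) :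
    E3 [⋀^Fin (k + 1)]→L[ℝ] ℝ :=
  ContinuousAlternatingMap.alternatizeUncurryFin
    (((ContinuousAlternatingMap.ofSubsingleton ℝ E3 ℝ (0 : Fin 1)).symm a).smulRight b)

theorem wedgeAlt_apply {k : ℕ} (a : E3 [⋀^Fin 1]→L[ℝ] ℝ) (b : E3 [⋀^Fin k]→L[ℝ] ℝ)
    (v : Fin (k + 1) → E3) :
    wedgeAlt a b v = ∑ i, (-1 : ℝ) ^ i.val * (a (fun _ => v i) * b (i.removeNth v)) := by
  rw [wedgeAlt, ContinuousAlternatingMap.alternatizeUncurryFin_apply]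
  refine Finset.sum_congr rfl fun i _ => ?_
  rw [← Int.cast_smul_eq_zsmul ℝ, smul_eq_mul]
  push_cast
  rfl

section Forms

variable (M : Type*) [TopologicalSpace M] [ChartedSpace E3 M]

/-- A (not necessarily continuous) differential `k`-form on `M`: an alternating `k`-form on each
tangent space. -/
abbrev DiffForm (k : ℕ) : Type _ := (x : M) → TangentSpace (𝓡 3) x [⋀^Fin k]→L[ℝ] ℝ

/-- A (not necessarily continuous) vector field on `M`. -/
abbrev VField : Type _ := (x : M) → TangentSpace (𝓡 3) x

variable {M}

/-- The expression of a form in a chart `e`, i.e. its pullback by `e⁻¹` (meaningful on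
`e.target`). -/
def inChart {k : ℕ} (e : OpenPartialHomeomorph M E3) (w : DiffForm M k) (y : E3) :
    E3 [⋀^Fin k]→L[ℝ] ℝ :=
  (w (e.symm y)).compContinuousLinearMap (mfderiv (𝓡 3) (𝓡 3) e.symm y)

/-- A form is smooth if its expression in every smooth chart is. -/
def IsSmoothForm {k : ℕ} (w : DiffForm M k) : Prop :=
  ∀ e ∈ IsManifold.maximalAtlas (𝓡 3) ∞ M, ContDiffOn ℝ ∞ (inChart e w) e.target

/-- A vector field is smooth if it is a smooth section of the tangent bundle. -/
def IsSmoothVField [IsManifold (𝓡 3) ∞ M] (X : VField M) : Prop :=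
  ContMDiff (𝓡 3) (𝓡 3).tangent ∞ (fun x => (⟨x, X x⟩ : TangentBundle (𝓡 3) M))

/-- The exterior derivative: at `x`, differentiate the expression of the form in the preferred
chart around `x` and pull the result back to `M` by that chart. -/
def extD {k : ℕ} (w : DiffForm M k) : DiffForm M (k + 1) := fun x =>
  ContinuousAlternatingMap.compContinuousLinearMap
    (M := TangentSpace (𝓡 3) x)
    (extDeriv (inChart (chartAt E3 x) w) (chartAt E3 x x))
    (mfderiv (𝓡 3) (𝓡 3) (chartAt E3 x) x)

/-- The interior product `i_X w = w(X, ·, …, ·)`. -/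
def interiorProd {k : ℕ} (X : VField M) (w : DiffForm M (k + 1)) : DiffForm M k := fun x =>
  ContinuousAlternatingMap.curryLeft (E := E3) (w x) (X x)

/-- The wedge product of a 1-form and a `k`-form. -/
def wedge {k : ℕ} (α : DiffForm M 1) (β : DiffForm M k) : DiffForm M (k + 1) := fun x =>
  wedgeAlt (α x) (β x)

/-- A volume form: a smooth nowhere vanishing form of top degree. -/
def IsVolumeForm (μ : DiffForm M 3) : Prop :=
  IsSmoothForm μ ∧ ∀ x, μ x ≠ 0

/-- `X` is a smooth vector field with `d i_X μ = 0`. -/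
def IsDivFree [IsManifold (𝓡 3) ∞ M] (μ : DiffForm M 3) (X : VField M) : Prop :=
  IsSmoothVField X ∧ extD (interiorProd X μ) = 0

/-! ### De Rham cohomology -/

theorem inChart_add {k : ℕ} (e : OpenPartialHomeomorph M E3) (w θ : DiffForm M k) :
    inChart e (w + θ) = inChart e w + inChart e θ := rfl

theorem inChart_smul {k : ℕ} (e : OpenPartialHomeomorph M E3) (c : ℝ) (w : DiffForm M k) :
    inChart e (c • w) = c • inChart e w := rfl

theorem inChart_zero {k : ℕ} (e : OpenPartialHomeomorph M E3) :
    inChart e (0 : DiffForm M k) = 0 := rfl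

theorem IsSmoothForm.zero {k : ℕ} : IsSmoothForm (0 : DiffForm M k) := by
  intro e _
  rw [inChart_zero]
  exact contDiffOn_const

theorem IsSmoothForm.add {k : ℕ} {w θ : DiffForm M k} (hw : IsSmoothForm w)
    (hθ : IsSmoothForm θ) : IsSmoothForm (w + θ) := by
  intro e he
  rw [inChart_add]
  exact (hw e he).add (hθ e he)

theorem IsSmoothForm.smul {k : ℕ} (c : ℝ) {w : DiffForm M k} (hw : IsSmoothForm w) :
    IsSmoothForm (c • w) := by
  intro e he
  rw [inChart_smul]
  exact (hw e he).const_smul c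

theorem IsSmoothForm.differentiableAt [IsManifold (𝓡 3) ∞ M] {k : ℕ} {w : DiffForm M k}
    (hw : IsSmoothForm w) (x : M) :
    DifferentiableAt ℝ (inChart (chartAt E3 x) w) (chartAt E3 x x) :=
  ((hw _ (IsManifold.chart_mem_maximalAtlas x)).contDiffAt
    ((chartAt E3 x).open_target.mem_nhds
      ((chartAt E3 x).map_source (mem_chart_source E3 x)))).differentiableAt (by simp)

theorem extD_add [IsManifold (𝓡 3) ∞ M] {k : ℕ} {w θ : DiffForm M k}
    (hw : IsSmoothForm w) (hθ : IsSmoothForm θ) : extD (w + θ) = extD w + extD θ := by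
  funext x
  simp only [extD, inChart_add, Pi.add_apply,
    extDeriv_add (hw.differentiableAt x) (hθ.differentiableAt x)]
  rfl

theorem extD_smul {k : ℕ} (c : ℝ) (w : DiffForm M k) : extD (c • w) = c • extD w := by
  funext x
  simp only [extD, inChart_smul, Pi.smul_apply, extDeriv_smul]
  rfl

theorem extD_zero {k : ℕ} : extD (0 : DiffForm M k) = 0 := by
  have h := extD_smul (0 : ℝ) (0 : DiffForm M k)
  rwa [zero_smul, zero_smul] at h

variable (M) [IsManifold (𝓡 3) ∞ M]

/-- The space of closed smooth `k`-forms. -/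
def closedForms (k : ℕ) : Submodule ℝ (DiffForm M k) where
  carrier := {w | IsSmoothForm w ∧ extD w = 0}
  add_mem' := fun ha hb => ⟨ha.1.add hb.1, by rw [extD_add ha.1 hb.1, ha.2, hb.2, add_zero]⟩
  zero_mem' := ⟨IsSmoothForm.zero, extD_zero⟩
  smul_mem' := fun c _ ha => ⟨ha.1.smul c, by rw [extD_smul, ha.2, smul_zero]⟩

instance closedFormsAddCommGroup (k : ℕ) : AddCommGroup (closedForms M k) :=
  (closedForms M k).addCommGroup

/-- The space of exact `k`-forms: the exterior derivatives of smooth `(k-1)`-forms, and only `0`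
in degree `0`. -/
def exactForms : (k : ℕ) → Submodule ℝ (DiffForm M k)
  | 0 => ⊥
  | _ + 1 =>
    { carrier := {w | ∃ θ, IsSmoothForm θ ∧ extD θ = w}
      add_mem' := by
        rintro _ _ ⟨a, ha, rfl⟩ ⟨b, hb, rfl⟩
        exact ⟨a + b, ha.add hb, extD_add ha hb⟩
      zero_mem' := ⟨0, IsSmoothForm.zero, extD_zero⟩
      smul_mem' := by
        rintro c _ ⟨a, ha, rfl⟩
        exact ⟨c • a, ha.smul c, extD_smul c a⟩ }

/-- Real (de Rham) cohomology `H^k(M)`: closed forms modulo exact forms. -/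
abbrev DeRhamCohomology (k : ℕ) : Type _ :=
  closedForms M k ⧸ (exactForms M k).submoduleOf (closedForms M k)

end Forms

/-! ### Orientation and integration -/

/-- An orientation of `M`, given by an oriented atlas: a family of smooth charts that covers `M`
and whose coordinate changes have positive Jacobian determinant. -/
structure OrientedAtlas (M : Type*) [TopologicalSpace M] [ChartedSpace E3 M] where
  charts : Set (OpenPartialHomeomorph M E3)
  smooth : charts ⊆ IsManifold.maximalAtlas (𝓡 3) ∞ M
  cover : ∀ x : M, ∃ e ∈ charts, x ∈ e.source
  det_pos : ∀ e ∈ charts, ∀ e' ∈ charts, ∀ y ∈ (e.symm.trans e').source,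
    0 < (fderiv ℝ (fun z => e' (e.symm z)) y).det

namespace OrientedAtlas

variable {M : Type*} [TopologicalSpace M] [ChartedSpace E3 M] [IsManifold (𝓡 3) ∞ M]
  [T2Space M] [CompactSpace M]

theorem exists_partition (o : OrientedAtlas M) :
    ∃ ρ : SmoothPartitionOfUnity o.charts (𝓡 3) M Set.univ,
      ρ.IsSubordinate (fun e => e.1.source) :=
  SmoothPartitionOfUnity.exists_isSubordinate (𝓡 3) isClosed_univ _
    (fun e => e.1.open_source) (fun x _ => by
      obtain ⟨e, he, hx⟩ := o.cover x
      exact Set.mem_iUnion.2 ⟨⟨e, he⟩, hx⟩)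

/-- A smooth partition of unity subordinate to the charts of the oriented atlas. -/
def partition (o : OrientedAtlas M) : SmoothPartitionOfUnity o.charts (𝓡 3) M Set.univ :=
  o.exists_partition.choose

/-- The integral `∫_M w` of a 3-form over the closed oriented manifold `M`: the sum over the
oriented charts `e` of the Lebesgue integrals over `e.target` of the coefficient of
`dx₁ ∧ dx₂ ∧ dx₃` in the expression of `ρ_e w`, for a partition of unity `ρ` subordinate to the
charts (only finitely many `ρ_e` are nonzero since `M` is compact). -/
def integral (o : OrientedAtlas M) (w : DiffForm M 3) : ℝ :=
  ∑ᶠ e : o.charts, ∫ y in e.1.target,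
    o.partition e (e.1.symm y) * inChart e.1 w y (EuclideanSpace.basisFun (Fin 3) ℝ)

end OrientedAtlas

/-! ### The Hopf invariant -/

section Hopf

variable {M : Type*} [TopologicalSpace M] [ChartedSpace E3 M] [IsManifold (𝓡 3) ∞ M]
  [T2Space M] [CompactSpace M]

/-- `η` is a smooth 1-form with `dη = i_X μ`. -/
def IsPrimitive (μ : DiffForm M 3) (X : VField M) (η : DiffForm M 1) : Prop :=
  IsSmoothForm η ∧ extD η = interiorProd X μ

/-- The integral `∫_M η ∧ i_Y μ`. -/
def hopfIntegral (o : OrientedAtlas M) (μ : DiffForm M 3) (η : DiffForm M 1) (Y : VField M) : ℝ :=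
  o.integral (wedge η (interiorProd Y μ))

open Classical in
/-- The Hopf invariant `H(X,Y) = ∫_M η_X ∧ i_Y μ`, for a chosen `η_X` with `dη_X = i_X μ`
(and `0` if there is none). -/
def hopfInvariant (o : OrientedAtlas M) (μ : DiffForm M 3) (X Y : VField M) : ℝ :=
  if h : ∃ η, IsPrimitive μ X η then hopfIntegral o μ h.choose Y else 0

end Hopf

end HopfInv

end

/-! Since `i_X μ` is closed, `H² = 0` supplies a primitive. Everything else rests on the identity `∫
α ∧ dβ = ∫ β ∧ dα` for smooth 1-forms (`integral_wedge_extD_comm`), which is Stokes for `α ∧ β`. If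
`dη = i_X μ` and `dζ = i_Y μ`, it reads `∫ η ∧ i_Y μ = ∫ ζ ∧ i_X μ`. This is the symmetry, and also
the independence of `η`, because the right side does not contain `η`. Additivity is linearity of the
integral for one fixed primitive of `X`.

The identity is additive in `α`, so a partition of unity reduces it to `α` supported in one oriented
chart. There the global integral is a single Lebesgue integral (`integral_eq_setIntegral`, by change
of variables), `d` is the Euclidean exterior derivative (`inChart_extD`), and the difference of the
two integrands is a signed sum of six derivatives `∂ₖ(aᵢ bⱼ)` of compactly supported functions, each
of integral zero (`integral_wedge_extDeriv_comm`). -/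

noncomputable section

namespace HopfInv

/-! ### Forms, vector fields and the exterior derivative in charts -/

section Charts

variable {M : Type*} [TopologicalSpace M] [ChartedSpace E3 M]

theorem contDiffAt_transition {e e' : OpenPartialHomeomorph M E3}
    (he : e ∈ IsManifold.maximalAtlas (𝓡 3) ∞ M) (he' : e' ∈ IsManifold.maximalAtlas (𝓡 3) ∞ M)
    {y : E3} (hy : y ∈ e.target) (hy' : e.symm y ∈ e'.source) :
    ContDiffAt ℝ ∞ (fun z => e' (e.symm z)) y :=
  contMDiffAt_iff_contDiffAt.1 <|
    (contMDiffAt_of_mem_maximalAtlas he' hy').comp y (contMDiffAt_symm_of_mem_maximalAtlas he hy)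

theorem mfderiv_comp_mfderiv_symm {e e' : OpenPartialHomeomorph M E3}
    (he : e ∈ IsManifold.maximalAtlas (𝓡 3) ∞ M) (he' : e' ∈ IsManifold.maximalAtlas (𝓡 3) ∞ M)
    {y : E3} (hy : y ∈ e.target) (hy' : e.symm y ∈ e'.source) :
    (mfderiv (𝓡 3) (𝓡 3) e' (e.symm y)).comp (mfderiv (𝓡 3) (𝓡 3) e.symm y) =
      fderiv ℝ (fun z => e' (e.symm z)) y := by
  have h := mfderiv_comp y
    ((contMDiffAt_of_mem_maximalAtlas he' hy').mdifferentiableAt (by simp))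
    ((contMDiffAt_symm_of_mem_maximalAtlas he hy).mdifferentiableAt (by simp))
  rw [← h, mfderiv_eq_fderiv]
  rfl

/-- Chain rule for `e⁻¹ = e'⁻¹ ∘ (e' ∘ e⁻¹)`, which holds near `y`. -/
theorem mfderiv_symm_eq_comp_fderiv {e e' : OpenPartialHomeomorph M E3}
    (he : e ∈ IsManifold.maximalAtlas (𝓡 3) ∞ M) (he' : e' ∈ IsManifold.maximalAtlas (𝓡 3) ∞ M)
    {y : E3} (hy : y ∈ e.target) (hy' : e.symm y ∈ e'.source) :
    (mfderiv (𝓡 3) (𝓡 3) e.symm y : E3 →L[ℝ] E3) =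
      (mfderiv (𝓡 3) (𝓡 3) e'.symm (e' (e.symm y)) : E3 →L[ℝ] E3).comp
        (fderiv ℝ (fun z => e' (e.symm z)) y) := by
  have hev : (e.symm : E3 → M) =ᶠ[𝓝 y] e'.symm ∘ fun z => e' (e.symm z) := by
    filter_upwards [(e.continuousAt_symm hy).preimage_mem_nhds (e'.open_source.mem_nhds hy')]
      with z hz
    exact (e'.left_inv hz).symm
  have h := mfderiv_comp (I := 𝓡 3) (I' := 𝓡 3) (I'' := 𝓡 3) (f := fun z => e' (e.symm z))
    (g := e'.symm) y
    ((contMDiffAt_symm_of_mem_maximalAtlas he' (e'.map_source hy')).mdifferentiableAt (by simp))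
    ((contMDiffAt_iff_contDiffAt.2
      (contDiffAt_transition he he' hy hy')).mdifferentiableAt (by simp))
  rw [mfderiv_eq_fderiv] at h
  exact hev.mfderiv_eq.trans h

/-- The expressions of a form in two charts are related by pullback along the coordinate change. -/
theorem inChart_eq_pullback {k : ℕ} {e e' : OpenPartialHomeomorph M E3}
    (he : e ∈ IsManifold.maximalAtlas (𝓡 3) ∞ M) (he' : e' ∈ IsManifold.maximalAtlas (𝓡 3) ∞ M)
    (w : DiffForm M k) {y : E3} (hy : y ∈ e.target) (hy' : e.symm y ∈ e'.source) :
    inChart e w y = (inChart e' w (e' (e.symm y))).compContinuousLinearMap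
      (fderiv ℝ (fun z => e' (e.symm z)) y) := by
  have h := mfderiv_symm_eq_comp_fderiv he he' hy hy'
  -- Forgetting that the fibre depends on the base point allows `left_inv` to rewrite that point.
  let w' : M → E3 [⋀^Fin k]→L[ℝ] ℝ := w
  change (w' (e.symm y)).compContinuousLinearMap _ =
    ((w' (e'.symm (e' (e.symm y)))).compContinuousLinearMap _).compContinuousLinearMap _
  rw [e'.left_inv hy']
  exact congrArg (w' (e.symm y)).compContinuousLinearMap h

theorem wedgeAlt_comp {k : ℕ} (a : E3 [⋀^Fin 1]→L[ℝ] ℝ) (b : E3 [⋀^Fin k]→L[ℝ] ℝ)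
    (A : E3 →L[ℝ] E3) :
    (wedgeAlt a b).compContinuousLinearMap A =
      wedgeAlt (a.compContinuousLinearMap A) (b.compContinuousLinearMap A) := by
  ext v
  simp only [ContinuousAlternatingMap.compContinuousLinearMap_apply, wedgeAlt_apply]
  rfl

theorem contDiffOn_wedgeAlt {k : ℕ} {a : E3 → E3 [⋀^Fin 1]→L[ℝ] ℝ}
    {b : E3 → E3 [⋀^Fin k]→L[ℝ] ℝ} {s : Set E3} (ha : ContDiffOn ℝ ∞ a s)
    (hb : ContDiffOn ℝ ∞ b s) : ContDiffOn ℝ ∞ (fun y => wedgeAlt (a y) (b y)) s := by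
  have h : ContDiffOn ℝ ∞ (fun y => ((ContinuousAlternatingMap.ofSubsingletonLIE (𝕜 := ℝ)
      (E := E3) (F := ℝ) (0 : Fin 1)).symm (a y) : E3 →L[ℝ] ℝ).smulRight (b y)) s :=
    ((ContinuousAlternatingMap.ofSubsingletonLIE (𝕜 := ℝ)
      (E := E3) (F := ℝ) (0 : Fin 1)).symm.contDiff.comp_contDiffOn ha).smulRight hb
  exact (ContinuousAlternatingMap.alternatizeUncurryFinCLM ℝ E3 ℝ).contDiff.comp_contDiffOn h

theorem inChart_wedge {k : ℕ} (e : OpenPartialHomeomorph M E3) (α : DiffForm M 1)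
    (β : DiffForm M k) (y : E3) :
    inChart e (wedge α β) y = wedgeAlt (inChart e α y) (inChart e β y) :=
  wedgeAlt_comp _ _ _

theorem contDiffOn_comp_symm {f : M → ℝ} (hf : ContMDiff (𝓡 3) 𝓘(ℝ, ℝ) ∞ f)
    {e : OpenPartialHomeomorph M E3} (he : e ∈ IsManifold.maximalAtlas (𝓡 3) ∞ M) :
    ContDiffOn ℝ ∞ (fun y => f (e.symm y)) e.target :=
  contMDiffOn_iff_contDiffOn.1 <|
    hf.comp_contMDiffOn (contMDiffOn_symm_of_mem_maximalAtlas he)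

theorem IsSmoothForm.wedge {k : ℕ} {α : DiffForm M 1} {β : DiffForm M k} (hα : IsSmoothForm α)
    (hβ : IsSmoothForm β) : IsSmoothForm (wedge α β) := fun e he =>
  (contDiffOn_wedgeAlt (hα e he) (hβ e he)).congr fun y _ => inChart_wedge e α β y

theorem IsSmoothForm.fun_smul {k : ℕ} {f : M → ℝ} (hf : ContMDiff (𝓡 3) 𝓘(ℝ, ℝ) ∞ f)
    {w : DiffForm M k} (hw : IsSmoothForm w) :
    IsSmoothForm (fun x => f x • w x : DiffForm M k) := fun e he =>
  (contDiffOn_comp_symm hf he).smul (hw e he)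

theorem mfderiv_symm_mfderiv_apply {e : OpenPartialHomeomorph M E3}
    (he : e ∈ IsManifold.maximalAtlas (𝓡 3) ∞ M) {y : E3} (hy : y ∈ e.target) (v : E3) :
    (mfderiv (𝓡 3) (𝓡 3) e.symm y : E3 →L[ℝ] E3)
      ((mfderiv (𝓡 3) (𝓡 3) e (e.symm y) : E3 →L[ℝ] E3) v) = v := by
  have hc := mfderiv_comp (e.symm y)
    ((contMDiffAt_symm_of_mem_maximalAtlas he
      (e.map_source (e.map_target hy))).mdifferentiableAt (by simp))
    ((contMDiffAt_of_mem_maximalAtlas he (e.map_target hy)).mdifferentiableAt (by simp))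
  have hev : (e.symm ∘ e : M → M) =ᶠ[𝓝 (e.symm y)] id := by
    filter_upwards [e.open_source.mem_nhds (e.map_target hy)] with z hz using e.left_inv hz
  have hid : mfderiv (𝓡 3) (𝓡 3) (e.symm ∘ e) (e.symm y) = ContinuousLinearMap.id ℝ E3 :=
    hev.mfderiv_eq.trans mfderiv_id
  have h := (DFunLike.congr_fun hc v).symm.trans (DFunLike.congr_fun hid v)
  let D : E3 → E3 →L[ℝ] E3 := fun z => mfderiv (𝓡 3) (𝓡 3) e.symm z
  change D (e (e.symm y)) _ = v at h
  rwa [e.right_inv hy] at h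

variable [IsManifold (𝓡 3) ∞ M]

/-- `extD` uses a different preferred chart at each point; this frees it from that choice. Near `y`
the expression in `e` is the pullback of the expression in the preferred chart `c`, and `extDeriv`
commutes with pullback. -/
theorem inChart_extD {k : ℕ} {e : OpenPartialHomeomorph M E3}
    (he : e ∈ IsManifold.maximalAtlas (𝓡 3) ∞ M) {w : DiffForm M k} (hw : IsSmoothForm w)
    {y : E3} (hy : y ∈ e.target) :
    inChart e (extD w) y = extDeriv (inChart e w) y := by
  set c := chartAt E3 (e.symm y)
  have hcm : c ∈ IsManifold.maximalAtlas (𝓡 3) ∞ M := IsManifold.chart_mem_maximalAtlas _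
  have hys : e.symm y ∈ c.source := mem_chart_source E3 _
  have hev : inChart e w =ᶠ[𝓝 y] fun z => (inChart c w (c (e.symm z))).compContinuousLinearMap
      (fderiv ℝ (fun z => c (e.symm z)) z) := by
    filter_upwards [(e.continuousAt_symm hy).preimage_mem_nhds (c.open_source.mem_nhds hys),
      e.open_target.mem_nhds hy] with z hz hz'
    exact inChart_eq_pullback he hcm w hz' hz
  rw [hev.extDeriv_eq, extDeriv_pullback (r := ∞) (f := fun z => c (e.symm z))
    (hw.differentiableAt (e.symm y)) (contDiffAt_transition he hcm hy hys)
    (by simp; exact WithTop.coe_le_coe.2 le_top),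
    ← mfderiv_comp_mfderiv_symm he hcm hy hys]
  rfl

theorem IsSmoothForm.extD {k : ℕ} {w : DiffForm M k} (hw : IsSmoothForm w) :
    IsSmoothForm (extD w) := by
  intro e he
  refine ContDiffOn.congr ?_ fun y hy => inChart_extD he hw hy
  have h := (hw e he).fderiv_of_isOpen e.open_target (m := ∞) (by simp)
  exact (ContinuousAlternatingMap.alternatizeUncurryFinCLM ℝ E3 ℝ).contDiff.comp_contDiffOn h

/-- The expression of a smooth vector field in a chart is smooth. -/
theorem IsSmoothVField.contDiffOn_inChart {X : VField M} (hX : IsSmoothVField X)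
    {e : OpenPartialHomeomorph M E3} (he : e ∈ IsManifold.maximalAtlas (𝓡 3) ∞ M) :
    ContDiffOn ℝ ∞
      (fun y => (mfderiv (𝓡 3) (𝓡 3) e (e.symm y) (X (e.symm y)) : E3)) e.target := by
  -- The expression of `X` is the fibre component of the tangent map of `e` along the section `X`.
  have h1 : ContMDiffOn (𝓡 3).tangent (𝓡 3).tangent ∞ (tangentMapWithin (𝓡 3) (𝓡 3) e e.source)
      (Bundle.TotalSpace.proj ⁻¹' e.source) :=
    (contMDiffOn_of_mem_maximalAtlas he).contMDiffOn_tangentMapWithin (by simp)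
      e.open_source.uniqueMDiffOn
  have h2 := h1.comp (hX.comp_contMDiffOn (contMDiffOn_symm_of_mem_maximalAtlas he))
    (fun y hy => e.map_target hy)
  have h3 := (contMDiff_snd_tangentBundle_modelSpace E3 (𝓡 3) (n := ∞)).comp_contMDiffOn h2
  refine (contMDiffOn_iff_contDiffOn.1 h3).congr fun y hy => ?_
  change _ = mfderivWithin (𝓡 3) (𝓡 3) e e.source (e.symm y) (X (e.symm y))
  rw [mfderivWithin_of_isOpen e.open_source (e.map_target hy)]

theorem IsSmoothForm.interiorProd {k : ℕ} {X : VField M} (hX : IsSmoothVField X)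
    {w : DiffForm M (k + 1)} (hw : IsSmoothForm w) : IsSmoothForm (interiorProd X w) := by
  intro e he
  have h : ContDiffOn ℝ ∞ (fun y => (ContinuousAlternatingMap.curryLeft (inChart e w y))
      (mfderiv (𝓡 3) (𝓡 3) e (e.symm y) (X (e.symm y)) : E3)) e.target := by
    refine ContDiffOn.clm_apply ?_ (hX.contDiffOn_inChart he)
    exact (ContinuousLinearMap.contDiff (F := E3 →L[ℝ] E3 [⋀^Fin k]→L[ℝ] ℝ)
      (ContinuousAlternatingMap.curryLeftLI (n := k) (𝕜 := ℝ) (E := E3)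
        (F := ℝ)).toContinuousLinearMap).comp_contDiffOn (hw e he)
  refine h.congr fun y hy => ?_
  -- Only the first slot needs an argument: `X` is recovered by pushing it into the chart and back.
  have h' := mfderiv_symm_mfderiv_apply he hy (X (e.symm y))
  ext v
  let W : E3 [⋀^Fin (k + 1)]→L[ℝ] ℝ := w (e.symm y)
  let A : E3 →L[ℝ] E3 := mfderiv (𝓡 3) (𝓡 3) e.symm y
  change W (Matrix.vecCons (X (e.symm y) : E3) (A ∘ v)) =
    W (A ∘ Matrix.vecCons ((mfderiv (𝓡 3) (𝓡 3) e (e.symm y) : E3 →L[ℝ] E3) (X (e.symm y))) v)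
  congr 1
  funext i
  refine Fin.cases ?_ (fun i => rfl) i
  exact h'.symm

end Charts

/-! ### Integration by parts in ℝ³ -/

section Euclidean

/-- The coordinate vectors of `ℝ³`. -/
abbrev coordVec (i : Fin 3) : E3 := EuclideanSpace.basisFun (Fin 3) ℝ i

/-- `U` and the complement of `K` are open and cover the space; on the latter the function is zero.
-/
theorem continuous_of_continuousOn_of_eq_zero {f : E3 → ℝ} {U K : Set E3} (hU : IsOpen U)
    (hK : IsCompact K) (hKU : K ⊆ U) (hf : ContinuousOn f U) (h0 : ∀ y ∉ K, f y = 0) :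
    Continuous f := by
  rw [continuous_iff_continuousAt]
  intro y
  by_cases hy : y ∈ K
  · exact hf.continuousAt (hU.mem_nhds (hKU hy))
  · refine (continuousAt_const (y := (0 : ℝ))).congr ?_
    filter_upwards [hK.isClosed.isOpen_compl.mem_nhds hy] with z hz
    exact (h0 z hz).symm

theorem integrable_of_continuousOn_of_eq_zero {f : E3 → ℝ} {U K : Set E3} (hU : IsOpen U)
    (hK : IsCompact K) (hKU : K ⊆ U) (hf : ContinuousOn f U) (h0 : ∀ y ∉ K, f y = 0) :
    Integrable f :=
  (continuous_of_continuousOn_of_eq_zero hU hK hKU hf h0).integrable_of_hasCompactSupport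
    (HasCompactSupport.intro hK h0)

theorem contDiff_of_contDiffOn_of_eq_zero {f : E3 → ℝ} {U K : Set E3} (hU : IsOpen U)
    (hK : IsCompact K) (hKU : K ⊆ U) (hf : ContDiffOn ℝ ∞ f U) (h0 : ∀ y ∉ K, f y = 0) :
    ContDiff ℝ ∞ f := by
  rw [contDiff_iff_contDiffAt]
  intro y
  by_cases hy : y ∈ K
  · exact hf.contDiffAt (hU.mem_nhds (hKU hy))
  · refine (contDiffAt_const (c := (0 : ℝ))).congr_of_eventuallyEq ?_
    filter_upwards [hK.isClosed.isOpen_compl.mem_nhds hy] with z hz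
    exact h0 z hz

theorem continuousOn_fderiv_apply {f : E3 → ℝ} {U : Set E3} (hU : IsOpen U)
    (hf : ContDiffOn ℝ ∞ f U) (v : E3) : ContinuousOn (fun y => fderiv ℝ f y v) U :=
  (hf.continuousOn_fderiv_of_isOpen hU (by simp)).clm_apply continuousOn_const

theorem fderiv_eq_zero_of_notMem {f : E3 → ℝ} {K : Set E3} (hK : IsCompact K)
    (h0 : ∀ y ∉ K, f y = 0) {y : E3} (hy : y ∉ K) : fderiv ℝ f y = 0 := by
  have : f =ᶠ[𝓝 y] fun _ => 0 := by
    filter_upwards [hK.isClosed.isOpen_compl.mem_nhds hy] with z hz using h0 z hz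
  rw [this.fderiv_eq]
  simp

theorem integrable_mul_fderiv {f g : E3 → ℝ} {U K : Set E3} (hU : IsOpen U)
    (hK : IsCompact K) (hKU : K ⊆ U) (hf : ContDiffOn ℝ ∞ f U) (h0 : ∀ y ∉ K, f y = 0)
    (hg : ContDiffOn ℝ ∞ g U) (v : E3) : Integrable fun y => f y * fderiv ℝ g y v :=
  integrable_of_continuousOn_of_eq_zero hU hK hKU
    (hf.continuousOn.mul (continuousOn_fderiv_apply hU hg v)) fun y hy => by simp [h0 y hy]

theorem integrable_mul_fderiv' {f g : E3 → ℝ} {U K : Set E3} (hU : IsOpen U)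
    (hK : IsCompact K) (hKU : K ⊆ U) (hf : ContDiffOn ℝ ∞ f U) (h0 : ∀ y ∉ K, f y = 0)
    (hg : ContDiffOn ℝ ∞ g U) (v : E3) : Integrable fun y => g y * fderiv ℝ f y v :=
  integrable_of_continuousOn_of_eq_zero hU hK hKU
    (hg.continuousOn.mul (continuousOn_fderiv_apply hU hf v)) fun y hy => by
      simp [fderiv_eq_zero_of_notMem hK h0 hy]

/-- Integration by parts for `f` smooth with compact support in `U` and `g` smooth on `U`. -/
theorem integral_mul_fderiv_eq_neg {f g : E3 → ℝ} {U K : Set E3} (hU : IsOpen U)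
    (hK : IsCompact K) (hKU : K ⊆ U) (hf : ContDiffOn ℝ ∞ f U) (h0 : ∀ y ∉ K, f y = 0)
    (hg : ContDiffOn ℝ ∞ g U) (v : E3) :
    ∫ y, f y * fderiv ℝ g y v = -∫ y, g y * fderiv ℝ f y v := by
  -- `g` is smooth only on `U`, so its differentiability is checked just on `tsupport f`, which lies
  -- in `U`.
  have hts : tsupport f ⊆ K := closure_minimal
    (fun y hy => by_contra fun h => hy (h0 y h)) hK.isClosed
  have h := integral_mul_fderiv_eq_neg_fderiv_mul_of_integrable (μ := (volume : Measure E3))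
    (f := f) (g := g) (v := v)
    (by simpa [mul_comm] using integrable_mul_fderiv' hU hK hKU hf h0 hg v)
    (integrable_mul_fderiv hU hK hKU hf h0 hg v)
    (integrable_of_continuousOn_of_eq_zero hU hK hKU (hf.continuousOn.mul hg.continuousOn)
      fun y hy => by simp [h0 y hy])
    (fun y _ => (contDiff_of_contDiffOn_of_eq_zero hU hK hKU hf h0).differentiable (by simp) y)
    (fun y hy => (hg.contDiffAt (hU.mem_nhds (hKU (hts hy)))).differentiableAt (by simp))
  rw [h]
  simp_rw [mul_comm]

theorem extDeriv_oneForm_apply {b : E3 → E3 [⋀^Fin 1]→L[ℝ] ℝ} {y : E3}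
    (hb : DifferentiableAt ℝ b y) (v : Fin 2 → E3) :
    extDeriv b y v = fderiv ℝ (fun z => b z (fun _ => v 1)) y (v 0) -
      fderiv ℝ (fun z => b z (fun _ => v 0)) y (v 1) := by
  have h0 : Fin.removeNth 0 v = fun _ : Fin 1 => v 1 := by
    funext i; rw [Subsingleton.elim i 0]; rfl
  have h1 : Fin.removeNth 1 v = fun _ : Fin 1 => v 0 := by
    funext i; rw [Subsingleton.elim i 0]; rfl
  rw [extDeriv_apply hb, Fin.sum_univ_two, h0, h1]
  simp [sub_eq_add_neg]

/-- The coefficient of `a ∧ db` in terms of partial derivatives of the coefficients of `b`. -/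
theorem wedgeAlt_extDeriv_apply (a : E3 [⋀^Fin 1]→L[ℝ] ℝ) {b : E3 → E3 [⋀^Fin 1]→L[ℝ] ℝ}
    {y : E3} (hb : DifferentiableAt ℝ b y) :
    wedgeAlt a (extDeriv b y) (EuclideanSpace.basisFun (Fin 3) ℝ) =
      a (fun _ => coordVec 0) * fderiv ℝ (fun z => b z (fun _ => coordVec 2)) y (coordVec 1) -
      a (fun _ => coordVec 0) * fderiv ℝ (fun z => b z (fun _ => coordVec 1)) y (coordVec 2) -
      a (fun _ => coordVec 1) * fderiv ℝ (fun z => b z (fun _ => coordVec 2)) y (coordVec 0) +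
      a (fun _ => coordVec 1) * fderiv ℝ (fun z => b z (fun _ => coordVec 0)) y (coordVec 2) +
      a (fun _ => coordVec 2) * fderiv ℝ (fun z => b z (fun _ => coordVec 1)) y (coordVec 0) -
      a (fun _ => coordVec 2) * fderiv ℝ (fun z => b z (fun _ => coordVec 0)) y (coordVec 1) := by
  rw [wedgeAlt_apply, Fin.sum_univ_three]
  simp only [extDeriv_oneForm_apply hb]
  simp [Fin.removeNth_apply, Fin.succAbove, Fin.lt_def]
  ring

/-- Stokes in coordinates: `a ∧ db - b ∧ da = -d(a ∧ b)`, and `a` makes the product compactly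
supported even though `b` is not. -/
theorem integral_wedge_extDeriv_comm {a b : E3 → E3 [⋀^Fin 1]→L[ℝ] ℝ} {U K : Set E3}
    (hU : IsOpen U) (hK : IsCompact K) (hKU : K ⊆ U) (ha : ContDiffOn ℝ ∞ a U)
    (h0 : ∀ y ∉ K, a y = 0) (hb : ContDiffOn ℝ ∞ b U) :
    ∫ y in U, (wedgeAlt (a y) (extDeriv b y) (EuclideanSpace.basisFun (Fin 3) ℝ) -
      wedgeAlt (b y) (extDeriv a y) (EuclideanSpace.basisFun (Fin 3) ℝ)) = 0 := by
  set A : Fin 3 → E3 → ℝ := fun i y => a y (fun _ => coordVec i) with hA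
  set B : Fin 3 → E3 → ℝ := fun i y => b y (fun _ => coordVec i) with hB
  have hev : ∀ v : Fin 1 → E3, ContDiff ℝ ∞ fun c : E3 [⋀^Fin 1]→L[ℝ] ℝ => c v := fun v =>
    (ContinuousAlternatingMap.apply ℝ E3 ℝ v).contDiff
  have hAs : ∀ i, ContDiffOn ℝ ∞ (A i) U := fun i => (hev _).comp_contDiffOn ha
  have hBs : ∀ i, ContDiffOn ℝ ∞ (B i) U := fun i => (hev _).comp_contDiffOn hb
  have hA0 : ∀ i, ∀ y ∉ K, A i y = 0 := fun i y hy => by simp [hA, h0 y hy]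
  have I1 : ∀ i j k, Integrable fun y => A i y * fderiv ℝ (B j) y (coordVec k) := fun i j k =>
    integrable_mul_fderiv hU hK hKU (hAs i) (hA0 i) (hBs j) _
  have I2 : ∀ i j k, Integrable fun y => B j y * fderiv ℝ (A i) y (coordVec k) := fun i j k =>
    integrable_mul_fderiv' hU hK hKU (hAs i) (hA0 i) (hBs j) _
  -- `G i j k` is `∂ₖ(aᵢ bⱼ)` expanded by the Leibniz rule.
  set G : Fin 3 → Fin 3 → Fin 3 → E3 → ℝ := fun i j k y =>
    A i y * fderiv ℝ (B j) y (coordVec k) + B j y * fderiv ℝ (A i) y (coordVec k) with hG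
  have hZ : ∀ i j k, Integrable (G i j k) ∧ ∫ y, G i j k y = 0 := fun i j k => by
    refine ⟨(I1 i j k).add (I2 i j k), ?_⟩
    rw [hG, integral_add (I1 i j k) (I2 i j k),
      integral_mul_fderiv_eq_neg hU hK hKU (hAs i) (hA0 i) (hBs j), neg_add_cancel]
  -- Integrability travels with the vanishing of the integral, since additivity of the integral
  -- requires it.
  have hadd : ∀ f g : E3 → ℝ, (Integrable f ∧ ∫ y, f y = 0) → (Integrable g ∧ ∫ y, g y = 0) →
      (Integrable (fun y => f y + g y) ∧ ∫ y, (f y + g y) = 0) := fun f g hf hg =>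
    ⟨hf.1.add hg.1, by rw [integral_add hf.1 hg.1, hf.2, hg.2, add_zero]⟩
  have hsub : ∀ f g : E3 → ℝ, (Integrable f ∧ ∫ y, f y = 0) → (Integrable g ∧ ∫ y, g y = 0) →
      (Integrable (fun y => f y - g y) ∧ ∫ y, (f y - g y) = 0) := fun f g hf hg =>
    ⟨hf.1.sub hg.1, by rw [integral_sub hf.1 hg.1, hf.2, hg.2, sub_zero]⟩
  have hsum : ∀ y ∈ U, (wedgeAlt (a y) (extDeriv b y) (EuclideanSpace.basisFun (Fin 3) ℝ) -
      wedgeAlt (b y) (extDeriv a y) (EuclideanSpace.basisFun (Fin 3) ℝ)) =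
      G 0 2 1 y - G 0 1 2 y - G 1 2 0 y + G 1 0 2 y + G 2 1 0 y - G 2 0 1 y := by
    intro y hy
    rw [wedgeAlt_extDeriv_apply _ ((hb.contDiffAt (hU.mem_nhds hy)).differentiableAt (by simp)),
      wedgeAlt_extDeriv_apply _ ((ha.contDiffAt (hU.mem_nhds hy)).differentiableAt (by simp))]
    simp only [hG, hA, hB]
    ring
  -- Off `U` both `aᵢ` and its derivative vanish, so the values of `b` there are harmless and the
  -- integral extends to the whole space.
  have hG0 : ∀ y ∉ U,
      G 0 2 1 y - G 0 1 2 y - G 1 2 0 y + G 1 0 2 y + G 2 1 0 y - G 2 0 1 y = 0 := by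
    intro y hy
    have hy' : y ∉ K := fun h => hy (hKU h)
    have : ∀ i j k, G i j k y = 0 := fun i j k => by
      simp only [hG, hA0 i y hy', fderiv_eq_zero_of_notMem hK (hA0 i) hy']
      simp
    simp [this]
  rw [setIntegral_congr_fun hU.measurableSet hsum,
    setIntegral_eq_integral_of_forall_compl_eq_zero hG0]
  exact (hsub _ _ (hadd _ _ (hadd _ _ (hsub _ _ (hsub _ _ (hZ 0 2 1) (hZ 0 1 2)) (hZ 1 2 0))
    (hZ 1 0 2)) (hZ 2 1 0)) (hZ 2 0 1)).2

end Euclidean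

/-- Top-degree alternating forms are multiples of the determinant of the basis. -/
theorem alternating_apply_comp_basis (c : E3 [⋀^Fin 3]→L[ℝ] ℝ) (A : E3 →L[ℝ] E3) :
    c.compContinuousLinearMap A (EuclideanSpace.basisFun (Fin 3) ℝ) =
      A.det * c (EuclideanSpace.basisFun (Fin 3) ℝ) := by
  have h := (EuclideanSpace.basisFun (Fin 3) ℝ).toBasis.det_comp (A : E3 →ₗ[ℝ] E3)
    (EuclideanSpace.basisFun (Fin 3) ℝ)
  have h1 := AlternatingMap.eq_smul_basis_det (EuclideanSpace.basisFun (Fin 3) ℝ).toBasis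
    c.toAlternatingMap
  have h2 := DFunLike.congr_fun h1 (A ∘ EuclideanSpace.basisFun (Fin 3) ℝ)
  have h3 : (EuclideanSpace.basisFun (Fin 3) ℝ).toBasis.det
      (EuclideanSpace.basisFun (Fin 3) ℝ) = 1 := by
    conv_lhs => rw [← OrthonormalBasis.coe_toBasis]
    exact Module.Basis.det_self _
  rw [h3, mul_one] at h
  change c (A ∘ EuclideanSpace.basisFun (Fin 3) ℝ) = _
  refine h2.trans ?_
  change c.toAlternatingMap (EuclideanSpace.basisFun (Fin 3) ℝ).toBasis *
    (EuclideanSpace.basisFun (Fin 3) ℝ).toBasis.det (A ∘ _) = _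
  rw [OrthonormalBasis.coe_toBasis, mul_comm]
  exact congrArg (· * c (EuclideanSpace.basisFun (Fin 3) ℝ)) h

/-! ### Supports in a chart -/

section Support

variable {M : Type*} [TopologicalSpace M]

theorem isCompact_image_chart {e : OpenPartialHomeomorph M E3} {K : Set M} (hK : IsCompact K)
    (hKe : K ⊆ e.source) : IsCompact (e '' K) :=
  hK.image_of_continuousOn (e.continuousOn.mono hKe)

theorem image_chart_subset {e : OpenPartialHomeomorph M E3} {K : Set M}
    (hKe : K ⊆ e.source) : e '' K ⊆ e.target := by
  rintro _ ⟨x, hx, rfl⟩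
  exact e.map_source (hKe hx)

theorem symm_notMem {e : OpenPartialHomeomorph M E3} {K : Set M} {y : E3} (hy : y ∈ e.target)
    (h : y ∉ e '' K) : e.symm y ∉ K := fun hK => h ⟨_, hK, e.right_inv hy⟩

/-- A function continuous on the target of a chart, vanishing off the image of a compact subset of
the source, is integrable on the target. -/
theorem integrableOn_chart {e : OpenPartialHomeomorph M E3} {K : Set M} (hK : IsCompact K)
    (hKe : K ⊆ e.source) {f : E3 → ℝ} (hf : ContinuousOn f e.target)
    (h0 : ∀ y ∈ e.target, e.symm y ∉ K → f y = 0) : IntegrableOn f e.target := by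
  rw [← integrable_indicator_iff e.open_target.measurableSet]
  refine integrable_of_continuousOn_of_eq_zero e.open_target (isCompact_image_chart hK hKe)
    (image_chart_subset hKe) (hf.congr fun y hy => Set.indicator_of_mem hy f) fun y hy => ?_
  by_cases hy' : y ∈ e.target
  · rw [Set.indicator_of_mem hy']
    exact h0 y hy' (symm_notMem hy' hy)
  · exact Set.indicator_of_notMem hy' f

variable [ChartedSpace E3 M]

theorem inChart_eq_zero {k : ℕ} (e : OpenPartialHomeomorph M E3) {w : DiffForm M k} {y : E3}
    (h : w (e.symm y) = 0) : inChart e w y = 0 := by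
  rw [inChart, h]
  rfl

/-- Since `K` is closed, the form vanishes on a neighbourhood of `x`, so its derivative at `x` does
too. -/
theorem extD_eq_zero_of_notMem {k : ℕ} {w : DiffForm M k} {K : Set M} (hK : IsClosed K)
    (h0 : ∀ x ∉ K, w x = 0) {x : M} (hx : x ∉ K) : extD w x = 0 := by
  set c := chartAt E3 x
  have hxs : x ∈ c.source := mem_chart_source E3 x
  have hev : inChart c w =ᶠ[𝓝 (c x)] fun _ => 0 := by
    have hc := c.continuousAt_symm (c.map_source hxs)
    rw [ContinuousAt, c.left_inv hxs] at hc
    filter_upwards [hc (hK.isOpen_compl.mem_nhds hx)] with z hz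
    exact inChart_eq_zero c (h0 _ hz)
  have : extDeriv (inChart c w) (c x) = 0 := by
    rw [hev.extDeriv_eq, extDeriv, fderiv_fun_const]
    exact map_zero (ContinuousAlternatingMap.alternatizeUncurryFinCLM ℝ E3 ℝ)
  rw [extD, this]
  rfl

theorem IsSmoothForm.continuousOn_coeff {w : DiffForm M 3} (hw : IsSmoothForm w)
    {e : OpenPartialHomeomorph M E3} (he : e ∈ IsManifold.maximalAtlas (𝓡 3) ∞ M) :
    ContinuousOn (fun y => inChart e w y (EuclideanSpace.basisFun (Fin 3) ℝ)) e.target :=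
  (ContinuousAlternatingMap.apply ℝ E3 ℝ
    (EuclideanSpace.basisFun (Fin 3) ℝ : Fin 3 → E3)).continuous.comp_continuousOn
    (hw e he).continuousOn

end Support

/-! ### The integral over an oriented atlas -/

namespace OrientedAtlas

variable {M : Type*} [TopologicalSpace M] [ChartedSpace E3 M] [IsManifold (𝓡 3) ∞ M]
  [T2Space M] [CompactSpace M]

theorem tsupport_partition_subset (o : OrientedAtlas M) (e : o.charts) :
    tsupport (o.partition e) ⊆ e.1.source :=
  o.exists_partition.choose_spec e

theorem partition_eq_zero (o : OrientedAtlas M) (e : o.charts) {x : M}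
    (hx : x ∉ tsupport (o.partition e)) : o.partition e x = 0 :=
  image_eq_zero_of_notMem_tsupport hx

theorem finite_partition_ne_zero (o : OrientedAtlas M) :
    {e : o.charts | (Function.support (o.partition e)).Nonempty}.Finite :=
  o.partition.locallyFinite.finite_nonempty_of_compact

/-- The finitely many charts on which the partition of unity is not identically zero. -/
def activeCharts (o : OrientedAtlas M) : Finset o.charts := o.finite_partition_ne_zero.toFinset

theorem partition_apply_eq_zero (o : OrientedAtlas M) {e : o.charts} (he : e ∉ o.activeCharts)
    (x : M) : o.partition e x = 0 := by
  by_contra h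
  exact he (o.finite_partition_ne_zero.mem_toFinset.2 ⟨x, h⟩)

theorem sum_partition (o : OrientedAtlas M) (x : M) :
    ∑ e ∈ o.activeCharts, o.partition e x = 1 := by
  rw [← o.partition.sum_eq_one (Set.mem_univ x)]
  refine (finsum_eq_sum_of_support_subset _ fun e he => ?_).symm
  by_contra h
  exact he (o.partition_apply_eq_zero h x)

theorem integral_eq_sum (o : OrientedAtlas M) (w : DiffForm M 3) :
    o.integral w = ∑ e ∈ o.activeCharts, ∫ y in e.1.target,
      o.partition e (e.1.symm y) * inChart e.1 w y (EuclideanSpace.basisFun (Fin 3) ℝ) := by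
  refine finsum_eq_sum_of_support_subset _ fun e he => ?_
  by_contra h
  exact he (by simp [o.partition_apply_eq_zero h])

theorem continuousOn_partition (o : OrientedAtlas M) (e : o.charts)
    {e' : OpenPartialHomeomorph M E3} :
    ContinuousOn (fun y => o.partition e (e'.symm y)) e'.target :=
  (o.partition e).contMDiff.continuous.comp_continuousOn e'.continuousOn_symm

theorem integrableOn_partition_mul (o : OrientedAtlas M) (e : o.charts) {w : DiffForm M 3}
    (hw : IsSmoothForm w) : IntegrableOn (fun y => o.partition e (e.1.symm y) *
      inChart e.1 w y (EuclideanSpace.basisFun (Fin 3) ℝ)) e.1.target :=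
  integrableOn_chart (isClosed_tsupport _).isCompact (o.tsupport_partition_subset e)
    ((o.continuousOn_partition e).mul (hw.continuousOn_coeff (o.smooth e.2)))
    fun y _ hy => by rw [o.partition_eq_zero e hy, zero_mul]

theorem integral_add (o : OrientedAtlas M) {w θ : DiffForm M 3} (hw : IsSmoothForm w)
    (hθ : IsSmoothForm θ) : o.integral (w + θ) = o.integral w + o.integral θ := by
  simp only [integral_eq_sum, ← Finset.sum_add_distrib]
  refine Finset.sum_congr rfl fun e _ => ?_
  rw [← MeasureTheory.integral_add (o.integrableOn_partition_mul e hw)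
    (o.integrableOn_partition_mul e hθ)]
  simp only [inChart_add, Pi.add_apply, ContinuousAlternatingMap.add_apply, mul_add]

/-- Change of variables: the term of the integral belonging to the chart `e'` can be computed in
the chart `e` if the form is supported in the source of `e`. -/
theorem setIntegral_partition_eq (o : OrientedAtlas M) {w : DiffForm M 3} {K : Set M}
    {e : OpenPartialHomeomorph M E3} (he : e ∈ o.charts) (hKe : K ⊆ e.source)
    (h0 : ∀ x ∉ K, w x = 0) (e' : o.charts) :
    ∫ y in e'.1.target, o.partition e' (e'.1.symm y) *
        inChart e'.1 w y (EuclideanSpace.basisFun (Fin 3) ℝ) =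
      ∫ y in e.target, o.partition e' (e.symm y) *
        inChart e w y (EuclideanSpace.basisFun (Fin 3) ℝ) := by
  set τ := e.symm.trans e'.1 with hτ
  have hsrc : ∀ z, z ∈ τ.source ↔ z ∈ e.target ∧ e.symm z ∈ e'.1.source := fun z => by
    simp [hτ]
  have htgt : ∀ z, z ∈ τ.target ↔ z ∈ e'.1.target ∧ e'.1.symm z ∈ e.source := fun z => by
    simp [hτ]
  -- Outside the overlap of the two charts the form vanishes, as `K` lies in `e.source`.
  have h1 : ∫ y in e'.1.target, o.partition e' (e'.1.symm y) *
        inChart e'.1 w y (EuclideanSpace.basisFun (Fin 3) ℝ) =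
      ∫ y in τ '' τ.source, o.partition e' (e'.1.symm y) *
        inChart e'.1 w y (EuclideanSpace.basisFun (Fin 3) ℝ) := by
    rw [τ.image_source_eq_target]
    refine setIntegral_eq_of_subset_of_forall_sdiff_eq_zero e'.1.open_target.measurableSet
      (fun z hz => ((htgt z).1 hz).1) fun z hz => ?_
    have : e'.1.symm z ∉ K := fun h => hz.2 ((htgt z).2 ⟨hz.1, hKe h⟩)
    rw [inChart_eq_zero _ (h0 _ this)]
    simp
  -- On this side it is the partition function that vanishes outside the overlap.
  have h2 : ∫ y in e.target, o.partition e' (e.symm y) *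
        inChart e w y (EuclideanSpace.basisFun (Fin 3) ℝ) =
      ∫ y in τ.source, o.partition e' (e.symm y) *
        inChart e w y (EuclideanSpace.basisFun (Fin 3) ℝ) := by
    refine setIntegral_eq_of_subset_of_forall_sdiff_eq_zero e.open_target.measurableSet
      (fun z hz => ((hsrc z).1 hz).1) fun z hz => ?_
    have : e.symm z ∉ e'.1.source := fun h => hz.2 ((hsrc z).2 ⟨hz.1, h⟩)
    rw [o.partition_eq_zero e' fun h => this (o.tsupport_partition_subset e' h), zero_mul]
  have hd : ∀ z ∈ τ.source, HasFDerivWithinAt τ (fderiv ℝ (fun z => e'.1 (e.symm z)) z)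
      τ.source z := fun z hz =>
    ((contDiffAt_transition (o.smooth he) (o.smooth e'.2) ((hsrc z).1 hz).1
      ((hsrc z).1 hz).2).differentiableAt (by simp)).hasFDerivAt.hasFDerivWithinAt
  rw [h1, h2, integral_image_eq_integral_abs_det_fderiv_smul volume τ.open_source.measurableSet
    hd τ.injOn]
  refine setIntegral_congr_fun τ.open_source.measurableSet fun z hz => ?_
  have hz' := (hsrc z).1 hz
  -- Orientation enters here: the change of variables produces `|det|`, the pullback of a 3-form
  -- produces `det`.
  have hpos := o.det_pos e he e'.1 e'.2 z hz
  have hτz : e'.1.symm (τ z) = e.symm z := e'.1.left_inv hz'.2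
  simp only [hτz, smul_eq_mul, abs_of_pos hpos]
  rw [inChart_eq_pullback (o.smooth he) (o.smooth e'.2) w hz'.1 hz'.2,
    alternating_apply_comp_basis]
  change _ * (_ * inChart e'.1 w (e'.1 (e.symm z)) _) = _
  ring

/-- The integral of a form with compact support in a chart is computed in that chart. -/
theorem integral_eq_setIntegral (o : OrientedAtlas M) {w : DiffForm M 3} (hw : IsSmoothForm w)
    {K : Set M} (hK : IsCompact K) {e : OpenPartialHomeomorph M E3} (he : e ∈ o.charts)
    (hKe : K ⊆ e.source) (h0 : ∀ x ∉ K, w x = 0) :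
    o.integral w = ∫ y in e.target, inChart e w y (EuclideanSpace.basisFun (Fin 3) ℝ) := by
  -- Once every term is moved to `e`, the partition functions add up to one under the integral.
  rw [integral_eq_sum, Finset.sum_congr rfl fun e' _ => o.setIntegral_partition_eq he hKe h0 e',
    ← integral_finsetSum]
  · simp only [← Finset.sum_mul, o.sum_partition, one_mul]
  · intro e' _
    refine integrableOn_chart hK hKe
      ((o.continuousOn_partition e').mul (hw.continuousOn_coeff (o.smooth he))) fun y _ hy => ?_
    rw [inChart_eq_zero e (h0 _ hy)]
    simp

end OrientedAtlas

/-! ### Linearity of the wedge and interior products -/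

section Algebra

theorem wedgeAlt_add_left {k : ℕ} (a a' : E3 [⋀^Fin 1]→L[ℝ] ℝ) (b : E3 [⋀^Fin k]→L[ℝ] ℝ) :
    wedgeAlt (a + a') b = wedgeAlt a b + wedgeAlt a' b := by
  ext v
  simp only [ContinuousAlternatingMap.add_apply, wedgeAlt_apply, ← Finset.sum_add_distrib]
  exact Finset.sum_congr rfl fun i _ => by ring

theorem wedgeAlt_add_right {k : ℕ} (a : E3 [⋀^Fin 1]→L[ℝ] ℝ) (b b' : E3 [⋀^Fin k]→L[ℝ] ℝ) :
    wedgeAlt a (b + b') = wedgeAlt a b + wedgeAlt a b' := by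
  ext v
  simp only [ContinuousAlternatingMap.add_apply, wedgeAlt_apply, ← Finset.sum_add_distrib]
  exact Finset.sum_congr rfl fun i _ => by ring

theorem wedgeAlt_zero_left {k : ℕ} (b : E3 [⋀^Fin k]→L[ℝ] ℝ) : wedgeAlt 0 b = 0 := by
  ext v
  simp [wedgeAlt_apply]

theorem wedgeAlt_zero_right {k : ℕ} (a : E3 [⋀^Fin 1]→L[ℝ] ℝ) :
    wedgeAlt a (0 : E3 [⋀^Fin k]→L[ℝ] ℝ) = 0 := by
  ext v
  simp [wedgeAlt_apply]

variable {M : Type*} [TopologicalSpace M] [ChartedSpace E3 M]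

theorem wedge_add_left {k : ℕ} (α α' : DiffForm M 1) (β : DiffForm M k) :
    wedge (α + α') β = wedge α β + wedge α' β :=
  funext fun _ => wedgeAlt_add_left _ _ _

theorem wedge_add_right {k : ℕ} (α : DiffForm M 1) (β β' : DiffForm M k) :
    wedge α (β + β') = wedge α β + wedge α β' :=
  funext fun _ => wedgeAlt_add_right _ _ _

theorem wedge_zero_left {k : ℕ} (β : DiffForm M k) : wedge 0 β = 0 :=
  funext fun _ => wedgeAlt_zero_left _

theorem wedge_zero_right {k : ℕ} (α : DiffForm M 1) : wedge α (0 : DiffForm M k) = 0 :=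
  funext fun _ => wedgeAlt_zero_right _

theorem interiorProd_add {k : ℕ} (X Y : VField M) (w : DiffForm M (k + 1)) :
    interiorProd (X + Y) w = interiorProd X w + interiorProd Y w :=
  funext fun x => map_add (ContinuousAlternatingMap.curryLeft (E := E3) (w x)) (X x) (Y x)

end Algebra

/-! ### Primitives, Stokes and the Hopf invariant -/

variable {M : Type*} [TopologicalSpace M] [ChartedSpace E3 M] [IsManifold (𝓡 3) ∞ M]

/-- If `H²(M) = 0`, every divergence-free vector field has a primitive. -/
theorem exists_isPrimitive (hH2 : Subsingleton (DeRhamCohomology M 2)) {μ : DiffForm M 3}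
    (hμ : IsSmoothForm μ) {X : VField M} (hX : IsDivFree μ X) : ∃ η, IsPrimitive μ X η := by
  have hc : interiorProd X μ ∈ closedForms M 2 := ⟨hμ.interiorProd hX.1, hX.2⟩
  have h : (⟨_, hc⟩ : closedForms M 2) ∈ (exactForms M 2).submoduleOf (closedForms M 2) :=
    (Submodule.Quotient.mk_eq_zero _).1 (Subsingleton.elim _ _)
  -- Exactness in degree 2 unfolds to the existence of a smooth primitive.
  exact h

variable [T2Space M] [CompactSpace M]

theorem integral_wedge_extD_comm_of_support (o : OrientedAtlas M) {α β : DiffForm M 1}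
    (hα : IsSmoothForm α) (hβ : IsSmoothForm β) {K : Set M} (hK : IsCompact K)
    {e : OpenPartialHomeomorph M E3} (he : e ∈ o.charts) (hKe : K ⊆ e.source)
    (h0 : ∀ x ∉ K, α x = 0) :
    o.integral (wedge α (extD β)) = o.integral (wedge β (extD α)) := by
  have hem := o.smooth he
  have h1 : ∀ x ∉ K, wedge α (extD β) x = 0 := fun x hx => by
    rw [wedge, h0 x hx]
    exact wedgeAlt_zero_left _
  have h2 : ∀ x ∉ K, wedge β (extD α) x = 0 := fun x hx => by
    rw [wedge, extD_eq_zero_of_notMem hK.isClosed h0 hx]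
    exact wedgeAlt_zero_right _
  have i1 : IntegrableOn (fun y => inChart e (wedge α (extD β)) y
      (EuclideanSpace.basisFun (Fin 3) ℝ)) e.target :=
    integrableOn_chart hK hKe ((hα.wedge hβ.extD).continuousOn_coeff hem) fun y _ hy => by
      rw [inChart_eq_zero e (h1 _ hy)]
      simp
  have i2 : IntegrableOn (fun y => inChart e (wedge β (extD α)) y
      (EuclideanSpace.basisFun (Fin 3) ℝ)) e.target :=
    integrableOn_chart hK hKe ((hβ.wedge hα.extD).continuousOn_coeff hem) fun y _ hy => by
      rw [inChart_eq_zero e (h2 _ hy)]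
      simp
  rw [o.integral_eq_setIntegral (hα.wedge hβ.extD) hK he hKe h1,
    o.integral_eq_setIntegral (hβ.wedge hα.extD) hK he hKe h2, ← sub_eq_zero, ← integral_sub i1 i2]
  -- Outside `e.target` the chart expression is meaningless; extension by zero makes it vanish
  -- everywhere off `e '' K`.
  set a : E3 → E3 [⋀^Fin 1]→L[ℝ] ℝ := e.target.indicator (inChart e α) with ha
  have haeq : ∀ y ∈ e.target, a y = inChart e α y := fun y hy => Set.indicator_of_mem hy _
  have ha0 : ∀ y ∉ e '' K, a y = 0 := fun y hy => by
    by_cases hy' : y ∈ e.target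
    · rw [haeq y hy']
      exact inChart_eq_zero e (h0 _ (symm_notMem hy' hy))
    · exact Set.indicator_of_notMem hy' _
  rw [← integral_wedge_extDeriv_comm e.open_target (isCompact_image_chart hK hKe)
    (image_chart_subset hKe) ((hα e hem).congr haeq) ha0 (hβ e hem)]
  refine setIntegral_congr_fun e.open_target.measurableSet fun y hy => ?_
  have hev : a =ᶠ[𝓝 y] inChart e α := by
    filter_upwards [e.open_target.mem_nhds hy] with z hz using haeq z hz
  simp only [inChart_wedge, inChart_extD hem hα hy, inChart_extD hem hβ hy, hev.extDeriv_eq,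
    haeq y hy]

/-- On a closed oriented manifold, `∫ α ∧ dβ = ∫ β ∧ dα` for smooth 1-forms `α` and `β`. -/
theorem integral_wedge_extD_comm (o : OrientedAtlas M) {α β : DiffForm M 1}
    (hα : IsSmoothForm α) (hβ : IsSmoothForm β) :
    o.integral (wedge α (extD β)) = o.integral (wedge β (extD α)) := by
  classical
  let γ : o.charts → DiffForm M 1 := fun e x => o.partition e x • α x
  have hγ : ∀ e, IsSmoothForm (γ e) := fun e => hα.fun_smul (o.partition e).contMDiff
  have hsum : ∑ e ∈ o.activeCharts, γ e = α := by
    funext x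
    rw [Finset.sum_apply]
    change ∑ e ∈ o.activeCharts, o.partition e x • α x = α x
    rw [← Finset.sum_smul, o.sum_partition, one_smul]
  -- Smoothness of the partial sums is part of the induction because `extD_add` and `integral_add`
  -- need it.
  have key : ∀ s : Finset o.charts, IsSmoothForm (∑ e ∈ s, γ e) ∧
      o.integral (wedge (∑ e ∈ s, γ e) (extD β)) =
        o.integral (wedge β (extD (∑ e ∈ s, γ e))) := by
    intro s
    induction s using Finset.induction_on with
    | empty =>
      rw [Finset.sum_empty, wedge_zero_left, extD_zero, wedge_zero_right]
      exact ⟨IsSmoothForm.zero, rfl⟩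
    | insert e s he ih =>
      rw [Finset.sum_insert he]
      refine ⟨(hγ e).add ih.1, ?_⟩
      rw [wedge_add_left, extD_add (hγ e) ih.1, wedge_add_right,
        o.integral_add ((hγ e).wedge hβ.extD) (ih.1.wedge hβ.extD),
        o.integral_add (hβ.wedge (hγ e).extD) (hβ.wedge ih.1.extD), ih.2,
        integral_wedge_extD_comm_of_support o (hγ e) hβ (isClosed_tsupport _).isCompact e.2
          (o.tsupport_partition_subset e) fun x hx => by
            simp only [γ, o.partition_eq_zero e hx, zero_smul]]
  have h := (key o.activeCharts).2
  rwa [hsum] at h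

theorem hopfIntegral_comm (o : OrientedAtlas M) {μ : DiffForm M 3} {X Y : VField M}
    {η ζ : DiffForm M 1} (hη : IsPrimitive μ X η) (hζ : IsPrimitive μ Y ζ) :
    hopfIntegral o μ η Y = hopfIntegral o μ ζ X := by
  rw [hopfIntegral, hopfIntegral, ← hη.2, ← hζ.2]
  exact integral_wedge_extD_comm o hη.1 hζ.1

theorem hopfIntegral_add (o : OrientedAtlas M) {μ : DiffForm M 3} (hμ : IsSmoothForm μ)
    {η : DiffForm M 1} (hη : IsSmoothForm η) {Y Z : VField M} (hY : IsSmoothVField Y)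
    (hZ : IsSmoothVField Z) :
    hopfIntegral o μ η (Y + Z) = hopfIntegral o μ η Y + hopfIntegral o μ η Z := by
  rw [hopfIntegral, interiorProd_add, wedge_add_right,
    o.integral_add (hη.wedge (hμ.interiorProd hY)) (hη.wedge (hμ.interiorProd hZ))]
  rfl

theorem hopfInvariant_eq_choose (o : OrientedAtlas M) {μ : DiffForm M 3} {X : VField M}
    (h : ∃ η, IsPrimitive μ X η) (Y : VField M) :
    hopfInvariant o μ X Y = hopfIntegral o μ h.choose Y :=
  dif_pos h

end HopfInv

end

theorem mainTheorem5 {M : Type*} [TopologicalSpace M] [ChartedSpace HopfInv.E3 M]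
    [IsManifold (𝓡 3) ∞ M] [T2Space M] [CompactSpace M]
    (o : HopfInv.OrientedAtlas M)
    (hH1 : Subsingleton (HopfInv.DeRhamCohomology M 1))
    (hH2 : Subsingleton (HopfInv.DeRhamCohomology M 2))
    (μ : HopfInv.DiffForm M 3) (hμ : HopfInv.IsVolumeForm μ)
    (X Y Z : HopfInv.VField M)
    (hX : HopfInv.IsDivFree μ X) (hY : HopfInv.IsDivFree μ Y) (hZ : HopfInv.IsDivFree μ Z) :
    (∃ η, HopfInv.IsPrimitive μ X η) ∧
    (∀ η η', HopfInv.IsPrimitive μ X η → HopfInv.IsPrimitive μ X η' →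
      HopfInv.hopfIntegral o μ η Y = HopfInv.hopfIntegral o μ η' Y) ∧
    (∀ η, HopfInv.IsPrimitive μ X η →
      HopfInv.hopfInvariant o μ X Y = HopfInv.hopfIntegral o μ η Y) ∧
    HopfInv.hopfInvariant o μ X Y = HopfInv.hopfInvariant o μ Y X ∧
    HopfInv.hopfInvariant o μ X (Y + Z) =
      HopfInv.hopfInvariant o μ X Y + HopfInv.hopfInvariant o μ X Z := by
  have hX' := HopfInv.exists_isPrimitive hH2 hμ.1 hX
  have hY' := HopfInv.exists_isPrimitive hH2 hμ.1 hY
  -- Both integrals equal `∫ ζ ∧ i_X μ` for one chosen primitive `ζ` of `i_Y μ`.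
  have hind : ∀ η η', HopfInv.IsPrimitive μ X η → HopfInv.IsPrimitive μ X η' →
      HopfInv.hopfIntegral o μ η Y = HopfInv.hopfIntegral o μ η' Y := fun η η' hη hη' =>
    (HopfInv.hopfIntegral_comm o hη hY'.choose_spec).trans
      (HopfInv.hopfIntegral_comm o hη' hY'.choose_spec).symm
  refine ⟨hX', hind, fun η hη => ?_, ?_, ?_⟩
  · rw [HopfInv.hopfInvariant_eq_choose o hX']
    exact hind _ _ hX'.choose_spec hη
  · rw [HopfInv.hopfInvariant_eq_choose o hX', HopfInv.hopfInvariant_eq_choose o hY']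
    exact HopfInv.hopfIntegral_comm o hX'.choose_spec hY'.choose_spec
  -- All three invariants use the same chosen primitive for `X`, so no primitive for `Y + Z` is
  -- required.
  · simp only [HopfInv.hopfInvariant_eq_choose o hX']
    exact HopfInv.hopfIntegral_add o hμ.1 hX'.choose_spec.1 hY.1 hZ.1
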